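/- Let $n\in\mathbb N$ and let $M$ be a simple finite-dimensional module over the complex Lie algebra $\mathfrak{sl}_n=\mathfrak{sl}_n(\mathbb C)$. Let $v\in M$ be a highest weight vector, that is, a nonzero vector for which there is a linear functional $\lambda$ on the space $\mathfrak h$ of trace-zero diagonal matrices with $H\cdot v=\lambda(H)v$ for all $H\in\mathfrak h$, and which satisfies $E_{i,j}\cdot v=0$ for all $i<j$. For $i>j$ let $F_{i,j}\in\mathfrak{sl}_n$ be the elementary matrix with entry $1$ in position $(i,j)$ and $0$ elsewhere. Fix any enumeration $p_1,\dots,p_N$ of the pairs $(i,j)$ with $1\le j<i\le n$, where $N=n(n-1)/2$, and for a multi-exponent $b=(b_p)_p$ of non-negative integers put $$\underline F^{\,b}=F_{p_1}^{\,b_{p_1}}F_{p_2}^{\,b_{p_2}}\cdots F_{p_N}^{\,b_{p_N}}\in U(\mathfrak{sl}_n),$$ where $U(\mathfrak{sl}_n)$ is the universal enveloping algebra, acting on $M$. Then there is a set $B$ of multi-exponents such that the vectors $\underline F^{\,b}\cdot v$, $b\in B$, are pairwise distinct and form a basis of $M$; that is, $M$ has a monomial basis. -/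

import Mathlib

/-- The Lie algebra `sl_n` over `ℂ`: trace zero `n × n` matrices with the commutator bracket. -/
abbrev SLn (n : ℕ) : Type :=
  LieAlgebra.SpecialLinear.sl (Fin n) ℂ

namespace SLn

/-- The diagonal matrices `h` in `sl_n`. -/
def diagonal (n : ℕ) : Submodule ℂ (SLn n) where
  carrier := {H | (H : Matrix (Fin n) (Fin n) ℂ).IsDiag}
  add_mem' := fun ha hb => Matrix.IsDiag.add ha hb
  zero_mem' := Matrix.isDiag_zero
  smul_mem' := fun c _ ha => Matrix.IsDiag.smul c ha

/-- The elementary matrix `E_{i,j}`, `i < j`, as an element of `sl_n`. -/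
noncomputable def E {n : ℕ} {i j : Fin n} (h : i < j) : SLn n :=
  LieAlgebra.SpecialLinear.single i j h.ne 1

/-- The positions `(i, j)`, `j < i`, strictly below the diagonal. -/
abbrev LowerIndex (n : ℕ) : Type :=
  {p : Fin n × Fin n // p.2 < p.1}

/-- The elementary matrix `F_{i,j}`, `j < i`, as an element of `sl_n`. -/
noncomputable def F {n : ℕ} (p : LowerIndex n) : SLn n :=
  LieAlgebra.SpecialLinear.single p.1.1 p.1.2 p.2.ne' 1

/-- `v` is a highest weight vector: a nonzero weight vector (for some weight `lam` in the dual of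
the diagonal matrices) that is annihilated by all `E_{i,j}` with `i < j`. -/
structure IsHighestWeightVector {n : ℕ} {M : Type*} [AddCommGroup M] [Module ℂ M]
    [LieRingModule (SLn n) M] (v : M) : Prop where
  ne_zero : v ≠ 0
  weight : ∃ lam : Module.Dual ℂ (diagonal n), ∀ H : diagonal n, ⁅(H : SLn n), v⁆ = lam H • v
  annihilated : ∀ (i j : Fin n) (h : i < j), ⁅E h, v⁆ = 0

/-- The monomial `F^b` in the universal enveloping algebra of `sl_n`: the product of the powers
`F_p ^ b_p`, taken in the order in which the positions `p` are listed in `l`. -/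
noncomputable def monomial {n : ℕ} (l : List (LowerIndex n)) (b : LowerIndex n → ℕ) :
    UniversalEnvelopingAlgebra ℂ (SLn n) :=
  (l.map fun p => UniversalEnvelopingAlgebra.ι ℂ (F p) ^ b p).prod

/-- The action of the universal enveloping algebra of `sl_n` on an `sl_n`-module. -/
noncomputable def act {n : ℕ} {M : Type*} [AddCommGroup M] [Module ℂ M]
    [LieRingModule (SLn n) M] [LieModule ℂ (SLn n) M]
    (u : UniversalEnvelopingAlgebra ℂ (SLn n)) (v : M) : M :=
  UniversalEnvelopingAlgebra.lift ℂ (LieModule.toEnd ℂ (SLn n) M) u v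

/-- The set of monomials `F^b`, `b ∈ B`, is a monomial basis of `M` (with respect to `v`): the
vectors `F^b . v`, `b ∈ B`, form a basis of `M`. -/
def IsMonomialBasis {n : ℕ} {M : Type*} [AddCommGroup M] [Module ℂ M]
    [LieRingModule (SLn n) M] [LieModule ℂ (SLn n) M]
    (l : List (LowerIndex n)) (v : M) (B : Set (LowerIndex n → ℕ)) : Prop :=
  ∃ bas : Module.Basis B ℂ M, ∀ b : B, bas b = act (monomial l b.1) v

end SLn

/-!
By irreducibility, `M` is spanned by the vectors `F_{q₁} ⋯ F_{q_k} v` for arbitrary words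
`q₁, …, q_k` of positions below the diagonal: an induction on the length of the word, using
`y F_q w = F_q y w + [y, F_q] w`, shows that their span is stable under every `y ∈ sl_n`
(`SLn.lie_wordVector_mem`). The base case is the decomposition of `y` into its strictly lower,
diagonal and strictly upper parts.

Words can then be replaced by ordered monomials, which is the spanning half of the
Poincaré–Birkhoff–Witt theorem for the strictly lower triangular matrices. The commutator of two
of the `F_p` is a linear combination of the `F_p`, so permuting the letters of a word changes the
product only by a combination of shorter words (`prod_sub_prod_mem_wordSpan_of_perm`), and one
concludes by induction on the length (`prod_mem_span_orderedMonomials`). Any spanning family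
contains a subfamily that is a basis; the members of a linearly independent subfamily are distinct,
so it can be indexed by a set of multi-exponents.
-/

/-! ### Ordered monomials in generators closed under commutators -/

section OrderedMonomials

variable {K A ι : Type*} [CommRing K] [Ring A] [Algebra K A]

/-- The span of the products of at most `k` factors taken from the family `x`. -/
def wordSpan (K : Type*) {A ι : Type*} [CommRing K] [Ring A] [Algebra K A] (x : ι → A) (k : ℕ) :
    Submodule K A :=
  Submodule.span K {a | ∃ w : List ι, w.length ≤ k ∧ (w.map x).prod = a}

lemma prod_mem_wordSpan (x : ι → A) {k : ℕ} {w : List ι} (hw : w.length ≤ k) :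
    (w.map x).prod ∈ wordSpan K x k :=
  Submodule.subset_span ⟨w, hw, rfl⟩

lemma mul_mem_wordSpan (x : ι → A) {k : ℕ} (i : ι) {a : A} (ha : a ∈ wordSpan K x k) :
    x i * a ∈ wordSpan K x (k + 1) := by
  have : wordSpan K x k ≤ (wordSpan K x (k + 1)).comap (LinearMap.mulLeft K (x i)) := by
    refine Submodule.span_le.2 ?_
    rintro _ ⟨w, hw, rfl⟩
    simpa using prod_mem_wordSpan (K := K) x (w := i :: w) (k := k + 1) (by simpa using hw)
  exact this ha

/-- If the span of the family `x` is closed under commutators, then a product of factors from `x`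
depends on their order only up to shorter products. -/
lemma prod_sub_prod_mem_wordSpan_of_perm (x : ι → A)
    (hx : ∀ i j, x i * x j - x j * x i ∈ Submodule.span K (Set.range x))
    {w w' : List ι} (h : w.Perm w') :
    (w.map x).prod - (w'.map x).prod ∈ wordSpan K x (w.length - 1) := by
  induction h with
  | nil => simp
  | @cons i w w' h ih =>
    cases w with
    | nil => simp [List.nil_perm.1 h]
    | cons j w =>
      have := mul_mem_wordSpan x i ih
      simpa [mul_sub] using this
  | swap i j w =>
    have key : Submodule.span K (Set.range x) ≤
        (wordSpan K x (w.length + 1)).comap (LinearMap.mulRight K (w.map x).prod) := by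
      refine Submodule.span_le.2 ?_
      rintro _ ⟨p, rfl⟩
      simpa using prod_mem_wordSpan (K := K) x (w := p :: w) (k := w.length + 1) (by simp)
    have := key (hx j i)
    simpa [sub_mul, mul_assoc] using this
  | trans h₁ h₂ ih₁ ih₂ =>
    rw [← h₁.length_eq] at ih₂
    simpa using add_mem ih₁ ih₂

lemma perm_flatMap_replicate_count [DecidableEq ι] {l : List ι} (hl : l.Nodup) (hl' : ∀ i, i ∈ l)
    (w : List ι) : w.Perm (l.flatMap fun i => List.replicate (w.count i) i) := by
  refine List.perm_iff_count.2 fun i => ?_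
  rw [List.count_flatMap]
  have : (List.count i ∘ fun j => List.replicate (w.count j) j) =
      fun j => if j = i then w.count i else 0 := by
    funext j
    by_cases h : j = i <;> simp [List.count_replicate, h]
  rw [this, ← List.sum_toFinset _ hl, Finset.sum_ite_eq', if_pos (List.mem_toFinset.2 (hl' i))]

/-- The spanning half of the Poincaré–Birkhoff–Witt theorem: if the span of the family `x` is closed
under commutators, then every product of factors from `x` is a linear combination of monomials with
the factors in the order prescribed by `l`. -/
lemma prod_mem_span_orderedMonomials (x : ι → A)
    (hx : ∀ i j, x i * x j - x j * x i ∈ Submodule.span K (Set.range x))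
    {l : List ι} (hl : l.Nodup) (hl' : ∀ i, i ∈ l) (w : List ι) :
    (w.map x).prod ∈
      Submodule.span K (Set.range fun b : ι → ℕ => (l.map fun i => x i ^ b i).prod) := by
  classical
  induction hk : w.length using Nat.strong_induction_on generalizing w with
  | _ k ih =>
  subst hk
  rcases Nat.eq_zero_or_pos w.length with h0 | hpos
  · obtain rfl := List.length_eq_zero_iff.1 h0
    exact Submodule.subset_span ⟨0, by simp⟩
  have hlow : wordSpan K x (w.length - 1) ≤
      Submodule.span K (Set.range fun b : ι → ℕ => (l.map fun i => x i ^ b i).prod) := by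
    refine Submodule.span_le.2 ?_
    rintro _ ⟨w', hw', rfl⟩
    exact ih _ (by omega) w' rfl
  have hperm := hlow <|
    prod_sub_prod_mem_wordSpan_of_perm x hx (perm_flatMap_replicate_count hl hl' w)
  have hsorted : ((l.flatMap fun i => List.replicate (w.count i) i).map x).prod =
      (l.map fun i => x i ^ w.count i).prod := by
    rw [List.map_flatMap, List.flatMap_def, List.prod_flatten, List.map_map]
    simp [Function.comp_def]
  rw [hsorted] at hperm
  have hmon : (l.map fun i => x i ^ w.count i).prod ∈
      Submodule.span K (Set.range fun b : ι → ℕ => (l.map fun i => x i ^ b i).prod) :=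
    Submodule.subset_span ⟨fun i => w.count i, rfl⟩
  exact (Submodule.sub_mem_iff_left _ hmon).1 hperm

end OrderedMonomials

namespace SLn

/-! ### The triangular decomposition of `sl_n` -/

variable {n : ℕ}

lemma sum_smul_F_apply (c : LowerIndex n → ℂ) (i j : Fin n) :
    (∑ p, c p • F p : SLn n).val i j = if h : j < i then c ⟨(i, j), h⟩ else 0 := by
  have hs : (∑ p, c p • F p : SLn n).val i j =
      ∑ p : LowerIndex n, if p.1 = (i, j) then c p else 0 := by
    simp [F, Matrix.sum_apply, Matrix.single_apply, Prod.ext_iff]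
  rw [hs]
  split_ifs with h
  · rw [Finset.sum_eq_single_of_mem (⟨(i, j), h⟩ : LowerIndex n) (Finset.mem_univ _)]
    · simp
    · exact fun p _ hp => if_neg fun hp' => hp (Subtype.ext hp')
  · refine Finset.sum_eq_zero fun p _ => if_neg fun hp => h ?_
    simpa [hp] using p.2

lemma sum_smul_E_apply (c : LowerIndex n → ℂ) (i j : Fin n) :
    (∑ p, c p • E p.2 : SLn n).val i j = if h : i < j then c ⟨(j, i), h⟩ else 0 := by
  have hs : (∑ p, c p • E p.2 : SLn n).val i j =
      ∑ p : LowerIndex n, if p.1 = (j, i) then c p else 0 := by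
    simp [E, Matrix.sum_apply, Matrix.single_apply, Prod.ext_iff, and_comm]
  rw [hs]
  split_ifs with h
  · rw [Finset.sum_eq_single_of_mem (⟨(j, i), h⟩ : LowerIndex n) (Finset.mem_univ _)]
    · simp
    · exact fun p _ hp => if_neg fun hp' => hp (Subtype.ext hp')
  · refine Finset.sum_eq_zero fun p _ => if_neg fun hp => h ?_
    simpa [hp] using p.2

lemma exists_eq_lower_add_diagonal_add_upper (y : SLn n) :
    ∃ (c d : LowerIndex n → ℂ) (H : diagonal n),
      y = ∑ p, c p • F p + H + ∑ p, d p • E p.2 := by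
  let c : LowerIndex n → ℂ := fun p => y.val p.1.1 p.1.2
  let d : LowerIndex n → ℂ := fun p => y.val p.1.2 p.1.1
  refine ⟨c, d, ⟨y - ∑ p, c p • F p - ∑ p, d p • E p.2, fun i j hij => ?_⟩, by dsimp only; abel⟩
  change y.val i j - (∑ p, c p • F p : SLn n).val i j - (∑ p, d p • E p.2 : SLn n).val i j = 0
  rw [sum_smul_F_apply, sum_smul_E_apply]
  rcases lt_or_gt_of_ne hij with h | h <;> simp [c, d, h, h.not_gt]

lemma mem_span_F_of_strictlyLower {y : SLn n} (hy : ∀ i j, i ≤ j → y.val i j = 0) :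
    y ∈ Submodule.span ℂ (Set.range (F (n := n))) := by
  have : y = ∑ p : LowerIndex n, y.val p.1.1 p.1.2 • F p := by
    refine Subtype.ext (Matrix.ext fun i j => ?_)
    rw [sum_smul_F_apply]
    split_ifs with h
    · rfl
    · exact hy i j (not_lt.1 h)
  rw [this]
  exact sum_mem fun p _ => Submodule.smul_mem _ _ (Submodule.subset_span ⟨p, rfl⟩)

lemma F_mul_F_apply_eq_zero (p q : LowerIndex n) {i j : Fin n} (hij : i ≤ j) :
    ((F p).val * (F q).val) i j = 0 := by
  rw [Matrix.mul_apply]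
  refine Finset.sum_eq_zero fun k _ => ?_
  simp only [F, LieAlgebra.SpecialLinear.val_single, Matrix.single_apply]
  have hp := p.2
  have hq := q.2
  split_ifs with h₁ h₂
  · obtain ⟨rfl, rfl⟩ := h₁
    obtain ⟨h₃, rfl⟩ := h₂
    rw [h₃] at hq
    exact absurd (hq.trans hp) hij.not_gt
  all_goals simp

lemma lie_F_F_mem_span (p q : LowerIndex n) :
    ⁅F p, F q⁆ ∈ Submodule.span ℂ (Set.range (F (n := n))) := by
  refine mem_span_F_of_strictlyLower fun i j hij => ?_
  rw [LieAlgebra.SpecialLinear.sl_bracket, Matrix.sub_apply, F_mul_F_apply_eq_zero p q hij,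
    F_mul_F_apply_eq_zero q p hij, sub_zero]

attribute [local instance] LieRing.ofAssociativeRing in
lemma ι_F_commutator_mem_span (p q : LowerIndex n) :
    UniversalEnvelopingAlgebra.ι ℂ (F p) * UniversalEnvelopingAlgebra.ι ℂ (F q) -
        UniversalEnvelopingAlgebra.ι ℂ (F q) * UniversalEnvelopingAlgebra.ι ℂ (F p) ∈
      Submodule.span ℂ (Set.range fun r : LowerIndex n => UniversalEnvelopingAlgebra.ι ℂ (F r)) := by
  rw [← LieRing.of_associative_ring_bracket, ← LieHom.map_lie]
  have := Submodule.mem_map_of_mem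
    (f := (UniversalEnvelopingAlgebra.ι ℂ : SLn n →ₗ⁅ℂ⁆ _).toLinearMap) (lie_F_F_mem_span p q)
  rw [Submodule.map_span, ← Set.range_comp] at this
  exact this

/-! ### Generating a simple module from a highest weight vector -/

variable {M : Type*} [AddCommGroup M] [Module ℂ M] [LieRingModule (SLn n) M]
  [LieModule ℂ (SLn n) M]

/-- The vector `F_{q₁} ⋯ F_{q_k} v` for the word `w = q₁ ⋯ q_k`. -/
noncomputable def wordVector (v : M) (w : List (LowerIndex n)) : M :=
  act (w.map fun p => UniversalEnvelopingAlgebra.ι ℂ (F p)).prod v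

lemma wordVector_nil (v : M) : wordVector (n := n) v [] = v := by
  simp [wordVector, act]

lemma wordVector_cons (v : M) (p : LowerIndex n) (w : List (LowerIndex n)) :
    wordVector v (p :: w) = ⁅F p, wordVector v w⁆ := by
  simp [wordVector, act]

/-- The span of the vectors `F_{q₁} ⋯ F_{q_k} v` is stable under `sl_n`. -/
lemma lie_wordVector_mem {v : M} (hv : IsHighestWeightVector (n := n) v)
    (w : List (LowerIndex n)) (y : SLn n) :
    ⁅y, wordVector v w⁆ ∈ Submodule.span ℂ (Set.range (wordVector (n := n) v)) := by
  have hword (w : List (LowerIndex n)) :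
      wordVector v w ∈ Submodule.span ℂ (Set.range (wordVector (n := n) v)) :=
    Submodule.subset_span ⟨w, rfl⟩
  induction w generalizing y with
  | nil =>
    obtain ⟨c, d, H, rfl⟩ := exists_eq_lower_add_diagonal_add_upper y
    obtain ⟨lam, hlam⟩ := hv.weight
    rw [add_lie, add_lie, sum_lie, sum_lie]
    refine add_mem (add_mem (sum_mem fun p _ => ?_) ?_) (sum_mem fun p _ => ?_)
    · rw [smul_lie, ← wordVector_cons]
      exact Submodule.smul_mem _ _ (hword _)
    · have := Submodule.smul_mem _ (lam H) (hword [])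
      rw [wordVector_nil, ← hlam H] at this
      rwa [wordVector_nil]
    · rw [smul_lie, wordVector_nil, hv.annihilated, smul_zero]
      exact zero_mem _
  | cons p w ih =>
    have hF : Submodule.span ℂ (Set.range (wordVector (n := n) v)) ≤
        (Submodule.span ℂ (Set.range (wordVector (n := n) v))).comap
          (LieModule.toEnd ℂ (SLn n) M (F p)) := by
      refine Submodule.span_le.2 ?_
      rintro _ ⟨w', rfl⟩
      simpa [← wordVector_cons] using hword (p :: w')
    rw [wordVector_cons, leibniz_lie]
    exact add_mem (ih _) (hF (ih y))

lemma span_wordVector_eq_top (hM : LieModule.IsIrreducible ℂ (SLn n) M) {v : M}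
    (hv : IsHighestWeightVector (n := n) v) :
    Submodule.span ℂ (Set.range (wordVector (n := n) v)) = ⊤ := by
  let N : LieSubmodule ℂ (SLn n) M :=
    { Submodule.span ℂ (Set.range (wordVector (n := n) v)) with
      lie_mem := fun {y} {m} hm => by
        have : Submodule.span ℂ (Set.range (wordVector (n := n) v)) ≤
            (Submodule.span ℂ (Set.range (wordVector (n := n) v))).comap
              (LieModule.toEnd ℂ (SLn n) M y) := by
          refine Submodule.span_le.2 ?_
          rintro _ ⟨w, rfl⟩
          exact lie_wordVector_mem hv w y
        exact this hm }
  have hvN : v ∈ N := Submodule.subset_span ⟨[], wordVector_nil v⟩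
  have hN : N = ⊤ := (eq_bot_or_eq_top N).resolve_left fun h => hv.ne_zero (by simpa [h] using hvN)
  exact congrArg LieSubmodule.toSubmodule hN

lemma span_monomial_eq_top (hM : LieModule.IsIrreducible ℂ (SLn n) M) {v : M}
    (hv : IsHighestWeightVector (n := n) v) {l : List (LowerIndex n)} (hl : l.Nodup)
    (hl' : ∀ p : LowerIndex n, p ∈ l) :
    Submodule.span ℂ (Set.range fun b : LowerIndex n → ℕ => act (monomial l b) v) = ⊤ := by
  rw [eq_top_iff, ← span_wordVector_eq_top hM hv]
  refine Submodule.span_le.2 ?_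
  rintro _ ⟨w, rfl⟩
  have := Submodule.mem_map_of_mem
    (f := (LinearMap.applyₗ v : Module.End ℂ M →ₗ[ℂ] M) ∘ₗ
      (UniversalEnvelopingAlgebra.lift ℂ (LieModule.toEnd ℂ (SLn n) M)).toLinearMap)
    (prod_mem_span_orderedMonomials (K := ℂ)
      (fun p : LowerIndex n => UniversalEnvelopingAlgebra.ι ℂ (F p))
      ι_F_commutator_mem_span hl hl' w)
  rw [Submodule.map_span, ← Set.range_comp] at this
  exact this

end SLn

theorem mainTheorem2 (n : ℕ) {M : Type*} [AddCommGroup M] [Module ℂ M]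
    [LieRingModule (SLn n) M] [LieModule ℂ (SLn n) M] [FiniteDimensional ℂ M]
    (hM : LieModule.IsIrreducible ℂ (SLn n) M)
    (v : M) (hv : SLn.IsHighestWeightVector (n := n) v)
    (l : List (SLn.LowerIndex n)) (hl_nodup : l.Nodup) (hl_all : ∀ p : SLn.LowerIndex n, p ∈ l) :
    ∃ B : Set (SLn.LowerIndex n → ℕ), SLn.IsMonomialBasis l v B := by
  obtain ⟨κ, a, ha, hspan, hli⟩ :=
    exists_linearIndependent' ℂ fun b : SLn.LowerIndex n → ℕ => SLn.act (SLn.monomial l b) v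
  rw [SLn.span_monomial_eq_top hM hv hl_nodup hl_all] at hspan
  refine ⟨Set.range a, (Module.Basis.mk hli hspan.ge).reindex (Equiv.ofInjective a ha), ?_⟩
  rintro ⟨_, k, rfl⟩
  have hk : (Equiv.ofInjective a ha).symm ⟨a k, k, rfl⟩ = k :=
    (Equiv.symm_apply_eq _).2 rfl
  rw [Module.Basis.reindex_apply, hk, Module.Basis.mk_apply]
  rfl
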